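/- Let $\mathbf X=(X,d,D,\alpha)$ be a computable complete metric space: $(X,d)$ is a complete metric space, $\alpha:\mathbb N\to X$ enumerates a dense set $D$, and $d(\alpha(i),\alpha(j))$ is a computable real uniformly in $i,j$. As an enumerated basis of $X$ take the balls $B(\alpha(i),r)$ with rational $r>0$. Let $\mathcal M(\mathbf X)$ be the space of Borel probability measures on $X$ with the weak topology, and write $\mu f=\int f\,d\mu$. As an enumerated basis of $\mathcal M(\mathbf X)$ take the finite intersections of sets $\{\mu:\mu\varphi<r\}$ and $\{\mu:\mu\varphi>r\}$, where $r\in\mathbb Q$ and $\varphi$ is a maximum of finitely many hat functions $g_{u,s,1/n}(x)=\max\bigl(0,\,1-n\max(0,d(x,u)-s)\bigr)$ with $u\in D$, $s\in\mathbb Q$, $n\ge 1$. On $X\times\mathcal M(\mathbf X)$ take the product basis. A function $f$ with values in $[0,\infty]$ on one of these spaces is lower semicomputable if $\{f>q\}$ is a recursively enumerable union of basis elements, uniformly in $q\in\mathbb Q$. A set $\mathcal C\subseteq\mathcal M(\mathbf X)$ is effectively compact if it is compact and the set of finite families of basis elements that cover $\mathcal C$ is recursively enumerable. A uniform test is a lower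 semicomputable $t:X\times\mathcal M(\mathbf X)\to[0,\infty]$, $(x,\mu)\mapsto t_\mu(x)$, with $\mu t_\mu\le1$ for all $\mu$. It is universal if for every uniform test $s$ there is a real constant $c>0$ with $s_\mu(x)\le c\,t_\mu(x)$ for all $x,\mu$. A $\mathcal C$-test is a lower semicomputable $f:X\to[0,\infty]$ with $\mu f\le1$ for all $\mu\in\mathcal C$. It is a universal $\mathcal C$-test if for every $\mathcal C$-test $g$ there is a real constant $c>0$ with $g(x)\le c\,f(x)$ for all $x$. Theorem. Let $\mathcal C\subseteq\mathcal M(\mathbf X)$ be effectively compact and let $t_\mu(x)$ be a universal uniform test. Then $$u(x)=\inf_{\mu\in\mathcal C}t_\mu(x)$$ is a universal $\mathcal C$-test: $u$ is lower semicomputable, $\mu u\le1$ for all $\mu\in\mathcal C$, and for every $\mathcal C$-test $f$ there is a real constant $c>0$ with $f(x)\le c\,u(x)$ for all $x\in X$. -/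

import Mathlib

open MeasureTheory
open scoped ENNReal NNReal

namespace AlgRandom

/-! ### Codes of rational numbers -/

/-- Codes of rational numbers by triples of natural numbers. -/
abbrev RatCode : Type := ℕ × ℕ × ℕ

/-- The rational number `(a - b) / (c + 1)`; every rational number is of this form. -/
def ratVal (q : RatCode) : ℚ := ((q.1 : ℚ) - (q.2.1 : ℚ)) / ((q.2.2 : ℚ) + 1)

/-- The nonnegative rational number `a / (b + 1)`. -/
noncomputable def nnRatVal (q : ℕ × ℕ) : ℝ≥0 := (q.1 : ℝ≥0) / ((q.2 : ℝ≥0) + 1)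

/-- The positive rational number `(a + 1) / (b + 1)`. -/
noncomputable def posRatVal (q : ℕ × ℕ) : ℝ := ((q.1 : ℝ) + 1) / ((q.2 : ℝ) + 1)

/-! ### Effectively enumerated bases, semicomputability, effective compactness -/

/-- Given a space `Y` with an effectively enumerated basis `B`, a function `f : Y → [0, ∞]` is lower
semicomputable if the sets `{y | q < f y}` are recursively enumerable unions of basis elements,
uniformly in the rational number `q ≥ 0` (for `q < 0` this set is all of `Y`). -/
def LowerSemicomputable {ι Y : Type*} [Primcodable ι] (B : ι → Set Y) (f : Y → ℝ≥0∞) : Prop :=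
  ∃ p : (ℕ × ℕ) × ι → Prop, REPred p ∧
    ∀ q : ℕ × ℕ, {y | (nnRatVal q : ℝ≥0∞) < f y} = ⋃ i ∈ {i | p (q, i)}, B i

/-- The product of two enumerated bases. -/
def prodBasis {ι κ Y Z : Type*} (B : ι → Set Y) (B' : κ → Set Z) : ι × κ → Set (Y × Z) :=
  fun i => B i.1 ×ˢ B' i.2

/-- A set `C` is effectively compact if it is compact and the finite families of basis elements that
cover it form a recursively enumerable set. -/
def EffectivelyCompact {ι Y : Type*} [TopologicalSpace Y] [Primcodable ι] (B : ι → Set Y)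
    (C : Set Y) : Prop :=
  IsCompact C ∧ REPred fun S : List ι => C ⊆ ⋃ i ∈ S, B i

/-! ### Computable metric spaces -/

/-- The sequence `α` turns the metric space `X` into a computable metric space: its range is dense,
and the distance of `α i` and `α j` is a computable function of `i` and `j`. -/
structure IsComputableMetricSpace {X : Type*} [MetricSpace X] (α : ℕ → X) : Prop where
  dense : DenseRange α
  computable_dist : ∃ g : (ℕ × ℕ) × ℕ → RatCode, Computable g ∧
    ∀ i j n : ℕ, |dist (α i) (α j) - (ratVal (g ((i, j), n)) : ℝ)| < 1 / ((n : ℝ) + 1)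

/-- The basis of the balls with center `α i` and positive rational radius. -/
def ballBasis {X : Type*} [MetricSpace X] (α : ℕ → X) : ℕ × (ℕ × ℕ) → Set X :=
  fun i => Metric.ball (α i.1) (posRatVal i.2)

/-! ### The space of probability measures -/

/-- The hat function: it is `1` on the ball of radius `r` around `u`, `0` outside the ball of radius
`r + ε`, and linear in the distance in between. -/
noncomputable def hat {X : Type*} [MetricSpace X] (u : X) (r ε : ℝ) (x : X) : ℝ :=
  max (1 - max (dist x u - r) 0 / ε) 0

/-- The maximum of finitely many hat functions with center `α i`, rational `r` and `ε = 1 / (n + 1)`.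
The value for the empty list is the zero function, which is the hat function with `r = -2` and
`ε = 1`. -/
noncomputable def maxHat {X : Type*} [MetricSpace X] (α : ℕ → X) (L : List (ℕ × RatCode × ℕ))
    (x : X) : ℝ :=
  L.foldr (fun h m => max (hat (α h.1) (ratVal h.2.1 : ℝ) (1 / ((h.2.2 : ℝ) + 1)) x) m) 0

/-- The subbasis of the weak topology on the probability measures that consists of the sets
`{μ | μ φ < r}` and `{μ | μ φ > r}` for rational `r` and finite maxima `φ` of hat functions. -/
def measureSubbasis {X : Type*} [MetricSpace X] [MeasurableSpace X] (α : ℕ → X) :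
    List (ℕ × RatCode × ℕ) × RatCode × Bool → Set (ProbabilityMeasure X)
  | (L, r, false) => {μ | ∫ x, maxHat α L x ∂(μ : Measure X) < (ratVal r : ℝ)}
  | (L, r, true) => {μ | (ratVal r : ℝ) < ∫ x, maxHat α L x ∂(μ : Measure X)}

/-- The basis of the finite intersections of subbasis elements. -/
def measureBasis {X : Type*} [MetricSpace X] [MeasurableSpace X] (α : ℕ → X) :
    List (List (ℕ × RatCode × ℕ) × RatCode × Bool) → Set (ProbabilityMeasure X) :=
  fun S => ⋂ s ∈ S, measureSubbasis α s

/-! ### Uniform tests and class tests -/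

/-- A uniform test: a function `(x, μ) ↦ t (x, μ)` that is jointly lower semicomputable (so that
`x ↦ t (x, μ)` is lower semicomputable relative to `μ`) and has `∫ t (x, μ) μ(dx) ≤ 1` for every
probability measure `μ`. -/
structure IsUniformTest {X : Type*} [MetricSpace X] [MeasurableSpace X] (α : ℕ → X)
    (t : X × ProbabilityMeasure X → ℝ≥0∞) : Prop where
  lowerSemicomputable : LowerSemicomputable (prodBasis (ballBasis α) (measureBasis α)) t
  lintegral_le : ∀ μ : ProbabilityMeasure X, ∫⁻ x, t (x, μ) ∂(μ : Measure X) ≤ 1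

/-- A universal uniform test: it dominates every uniform test to within a multiplicative constant. -/
structure IsUniversalUniformTest {X : Type*} [MetricSpace X] [MeasurableSpace X] (α : ℕ → X)
    (t : X × ProbabilityMeasure X → ℝ≥0∞) : Prop where
  isUniformTest : IsUniformTest α t
  dominates : ∀ s : X × ProbabilityMeasure X → ℝ≥0∞, IsUniformTest α s →
    ∃ c : ℝ≥0, 0 < c ∧ ∀ (x : X) (μ : ProbabilityMeasure X), s (x, μ) ≤ c * t (x, μ)

/-- A test for the class `C` of probability measures. -/
structure IsClassTest {X : Type*} [MetricSpace X] [MeasurableSpace X] (α : ℕ → X)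
    (C : Set (ProbabilityMeasure X)) (f : X → ℝ≥0∞) : Prop where
  lowerSemicomputable : LowerSemicomputable (ballBasis α) f
  lintegral_le : ∀ μ ∈ C, ∫⁻ x, f x ∂(μ : Measure X) ≤ 1

/-- A universal test for the class `C`: it dominates every test for `C` to within a multiplicative
constant. -/
structure IsUniversalClassTest {X : Type*} [MetricSpace X] [MeasurableSpace X] (α : ℕ → X)
    (C : Set (ProbabilityMeasure X)) (u : X → ℝ≥0∞) : Prop where
  isClassTest : IsClassTest α C u
  dominates : ∀ f : X → ℝ≥0∞, IsClassTest α C f →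
    ∃ c : ℝ≥0, 0 < c ∧ ∀ x : X, f x ≤ c * u x

end AlgRandom

/-! ### Closure properties of recursively enumerable predicates. -/

section RecursivelyEnumerable

variable {α β γ : Type*} [Primcodable α] [Primcodable β] [Primcodable γ]

/-! The integral bound is immediate from `u ≤ t_μ` for `μ ∈ C`. For lower semicomputability, `q < u
x` holds iff, for some rational `q' > q`, finitely many basic products enumerated into `{t > q'}`
have first factors containing `x` and second factors covering `C`. Compactness supplies the finite
family, and effective compactness makes the covering semidecidable
(`LowerSemicomputable.iInf_of_effectivelyCompact`).

For universality, a `C`-test `f` is turned into a uniform test `s` with `f ≤ 3 s_μ` for all `μ ∈ C`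
(`IsClassTest.exists_isUniformTest`); universality of `t` and an infimum over `C` then finish. Balls
inside the superlevel sets `{f > k}`, `k ∈ ℕ`, are enumerated and softened to hat functions. Stage
`n` gives a continuous function `layerSum`, an approximate count of the integers below `f x`, hence
at most `f x + 1`. Its integral is at most 2 for `μ ∈ C` but is uncontrolled for other `μ`, so a
stage is admitted only while its integral is below 3. This condition on `μ` is a recursively
enumerable union of basis elements, because the layers are maxima of hat functions. Dividing by 3
gives a uniform test (`trimmedTest`), and on `C` nothing is trimmed. -/

theorem REPred.exists_nat_of_primrecRel {R : α → ℕ → Prop} (hR : PrimrecRel R) :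
    REPred fun a => ∃ n, R a n := by
  classical
  have h : Partrec fun a => Nat.rfind (fun n => Part.some (decide (R a n)) : ℕ →. Bool) :=
    Partrec.rfind (hR.decide.to_comp.partrec.to₂)
  refine h.dom_re.of_eq fun a => Nat.rfind_dom.trans ?_
  simp

/-- Kleene's normal form for recursively enumerable predicates. -/
theorem REPred.exists_primrecRel {p : α → Prop} (hp : REPred p) :
    ∃ R : α → ℕ → Prop, PrimrecRel R ∧ ∀ a, p a ↔ ∃ n, R a n := by
  obtain ⟨c, hc⟩ := Nat.Partrec.Code.exists_code.1 hp
  refine ⟨fun a n => (Nat.Partrec.Code.evaln n c (Encodable.encode a)).isSome = true, ?_, ?_⟩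
  · have h : Primrec fun x : α × ℕ =>
        (Nat.Partrec.Code.evaln x.2 c (Encodable.encode x.1)).isSome :=
      Primrec.option_isSome.comp (Nat.Partrec.Code.primrec_evaln.comp
        ((Primrec.snd.pair (Primrec.const c)).pair (Primrec.encode.comp Primrec.fst)))
    exact PrimrecPred.of_eq (Primrec.primrecPred (p := fun x : α × ℕ =>
      (Nat.Partrec.Code.evaln x.2 c (Encodable.encode x.1)).isSome = true) (h.of_eq fun x => by simp))
      fun x => Iff.rfl
  · intro a
    have h1 : p a ↔ (Nat.Partrec.Code.eval c (Encodable.encode a)).Dom := by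
      rw [hc]
      simp [Part.assert]
    rw [h1, Part.dom_iff_mem]
    simp only [Nat.Partrec.Code.evaln_complete, Option.isSome_iff_exists]
    exact exists_comm

theorem REPred.of_primrecPred {p : α → Prop} (hp : PrimrecPred p) : REPred p := by
  classical
  exact ComputablePred.to_re ⟨inferInstance, hp.decide.to_comp⟩

theorem REPred.comp {p : β → Prop} {f : α → β} (hp : REPred p) (hf : Computable f) :
    REPred fun a => p (f a) :=
  Partrec.comp (f := fun b => Part.assert (p b) fun _ => Part.some ()) hp hf

theorem REPred.and {p q : α → Prop} (hp : REPred p) (hq : REPred q) :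
    REPred fun a => p a ∧ q a := by
  obtain ⟨R, hR, hpR⟩ := hp.exists_primrecRel
  obtain ⟨S, hS, hqS⟩ := hq.exists_primrecRel
  have h : PrimrecRel fun (a : α) (n : ℕ) => R a n.unpair.1 ∧ S a n.unpair.2 :=
    (hR.comp Primrec.fst (Primrec.fst.comp (Primrec.unpair.comp Primrec.snd))).and
      (hS.comp Primrec.fst (Primrec.snd.comp (Primrec.unpair.comp Primrec.snd)))
  refine (REPred.exists_nat_of_primrecRel h).of_eq fun a => ?_
  rw [hpR, hqS]
  constructor
  · rintro ⟨n, h1, h2⟩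
    exact ⟨⟨_, h1⟩, ⟨_, h2⟩⟩
  · rintro ⟨⟨n, h1⟩, ⟨m, h2⟩⟩
    exact ⟨Nat.pair n m, by simpa using ⟨h1, h2⟩⟩

theorem REPred.exists {p : α × β → Prop} (hp : REPred p) : REPred fun a => ∃ b, p (a, b) := by
  obtain ⟨R, hR, hpR⟩ := hp.exists_primrecRel
  have h : PrimrecRel fun (a : α) (n : ℕ) =>
      ∃ b ∈ (Encodable.decode (α := β) n.unpair.1).toList, R (a, b) n.unpair.2 := by
    have h1 : PrimrecRel fun (b : β) (x : α × ℕ) => R (x.1, b) x.2.unpair.2 :=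
      hR.comp ((Primrec.fst.comp Primrec.snd).pair Primrec.fst)
        (Primrec.snd.comp (Primrec.unpair.comp (Primrec.snd.comp Primrec.snd)))
    have h2 : Primrec fun o : Option β => o.toList := by
      refine (Primrec.option_casesOn Primrec.id (Primrec.const [])
        (Primrec.list_cons.comp Primrec.snd (Primrec.const [])).to₂).of_eq fun o => ?_
      cases o <;> rfl
    exact h1.exists_mem_list.comp (h2.comp (Primrec.decode.comp
      (Primrec.fst.comp (Primrec.unpair.comp Primrec.snd)))) Primrec.id
  refine (REPred.exists_nat_of_primrecRel h).of_eq fun a => ?_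
  simp only [hpR]
  constructor
  · rintro ⟨n, b, -, h⟩
    exact ⟨b, _, h⟩
  · rintro ⟨b, n, h⟩
    exact ⟨Nat.pair (Encodable.encode b) n, b, by simp, by simpa using h⟩

/-- Witnesses for the finitely many entries have a common bound `n`, so the existential quantifier
moves in front of the list quantifier and leaves a primitive recursive matrix. -/
theorem REPred.forall_mem_list {p : α × β → Prop} (hp : REPred p) :
    REPred fun x : α × List β => ∀ b ∈ x.2, p (x.1, b) := by
  obtain ⟨R, hR, hpR⟩ := hp.exists_primrecRel
  have h0 : PrimrecRel fun (m : ℕ) (x : α × β) => R x m := hR.comp Primrec.snd Primrec.fst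
  have h1 : PrimrecRel fun (b : β) (x : α × ℕ) => ∃ m < x.2, R (x.1, b) m :=
    (h0.exists_mem_list.comp (Primrec.list_range.comp (Primrec.snd.comp Primrec.snd))
      ((Primrec.fst.comp Primrec.snd).pair Primrec.fst)).of_eq
      fun x => by simp
  have h2 : PrimrecRel fun (x : α × List β) (n : ℕ) => ∀ b ∈ x.2, ∃ m < n, R (x.1, b) m :=
    h1.forall_mem_list.comp (Primrec.snd.comp Primrec.fst)
      ((Primrec.fst.comp Primrec.fst).pair Primrec.snd)
  refine (REPred.exists_nat_of_primrecRel h2).of_eq ?_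
  rintro ⟨a, l⟩
  simp only [hpR]
  constructor
  · rintro ⟨n, h⟩ b hb
    obtain ⟨m, -, hm⟩ := h b hb
    exact ⟨m, hm⟩
  · intro h
    induction l with
    | nil => exact ⟨0, by simp⟩
    | cons b l ih =>
      obtain ⟨n, hn⟩ := ih fun c hc => h c (List.mem_cons_of_mem _ hc)
      obtain ⟨m, hm⟩ := h b List.mem_cons_self
      refine ⟨max n (m + 1), fun c hc => ?_⟩
      rcases List.mem_cons.1 hc with rfl | hc
      · exact ⟨m, by omega, hm⟩
      · obtain ⟨k, hk, hk'⟩ := hn c hc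
        exact ⟨k, by omega, hk'⟩

/-- A recursively enumerable set is exhausted by a primitive recursive increasing sequence of
finite lists. -/
theorem REPred.exists_stages {p : α → Prop} (hp : REPred p) :
    ∃ W : ℕ → List α, Primrec W ∧ (∀ m n, m ≤ n → W m ⊆ W n) ∧ ∀ a, p a ↔ ∃ n, a ∈ W n := by
  classical
  obtain ⟨R, hR, hpR⟩ := hp.exists_primrecRel
  -- `j` codes a candidate together with a proposed witness; the candidate is output only if the
  -- witness checks.
  let e : ℕ → Option α := fun j =>
    (Encodable.decode (α := α) j.unpair.1).bind fun a => if R a j.unpair.2 then some a else none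
  have he : Primrec e :=
    Primrec.option_bind (Primrec.decode.comp (Primrec.fst.comp Primrec.unpair))
      (Primrec.ite (hR.comp Primrec.snd (Primrec.snd.comp (Primrec.unpair.comp Primrec.fst)))
        (Primrec.option_some.comp Primrec.snd) (Primrec.const none)).to₂
  refine ⟨fun n => (List.range n).filterMap e,
    Primrec.listFilterMap Primrec.list_range (he.comp Primrec.snd).to₂, ?_, ?_⟩
  · intro m n hmn a ha
    obtain ⟨j, hj, hja⟩ := List.mem_filterMap.1 ha
    exact List.mem_filterMap.2
      ⟨j, List.mem_range.2 ((List.mem_range.1 hj).trans_le hmn), hja⟩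
  · intro a
    rw [hpR]
    constructor
    · rintro ⟨n, hn⟩
      refine ⟨Nat.pair (Encodable.encode a) n + 1, List.mem_filterMap.2
        ⟨Nat.pair (Encodable.encode a) n, List.mem_range.2 (Nat.lt_succ_self _), ?_⟩⟩
      simp [e, hn]
    · rintro ⟨n, hn⟩
      obtain ⟨j, -, hj⟩ := List.mem_filterMap.1 hn
      obtain ⟨b, -, hb⟩ := Option.bind_eq_some_iff.1 hj
      split_ifs at hb with h
      exact ⟨_, (Option.some.inj hb) ▸ h⟩

end RecursivelyEnumerable

namespace AlgRandom

/-! ### Hat functions and their finite maxima. -/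

section Hat

variable {X : Type*} [MetricSpace X]

theorem continuous_hat (u : X) (r ε : ℝ) : Continuous (hat u r ε) := by
  unfold hat
  fun_prop

theorem hat_le_one (u : X) (r : ℝ) {ε : ℝ} (hε : 0 < ε) (x : X) : hat u r ε x ≤ 1 :=
  max_le (sub_le_self _ (div_nonneg (le_max_right _ _) hε.le)) zero_le_one

theorem hat_eq_one {u : X} {r ε : ℝ} {x : X} (h : dist x u ≤ r) : hat u r ε x = 1 := by
  unfold hat
  rw [max_eq_right (sub_nonpos.2 h)]
  simp

theorem hat_eq_zero {u : X} {r ε : ℝ} (hε : 0 < ε) {x : X} (h : r + ε ≤ dist x u) :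
    hat u r ε x = 0 := by
  unfold hat
  refine max_eq_right ?_
  rw [sub_nonpos, le_div_iff₀ hε]
  exact le_max_of_le_left (by linarith)

theorem continuous_maxHat (α : ℕ → X) (L : List (ℕ × RatCode × ℕ)) : Continuous (maxHat α L) := by
  induction L with
  | nil => exact continuous_const
  | cons h L ih => exact (continuous_hat _ _ _).max ih

theorem maxHat_nonneg (α : ℕ → X) (L : List (ℕ × RatCode × ℕ)) (x : X) : 0 ≤ maxHat α L x := by
  induction L with
  | nil => exact le_rfl
  | cons h L ih => exact le_max_of_le_right ih

theorem maxHat_le {α : ℕ → X} {L : List (ℕ × RatCode × ℕ)} {x : X} {c : ℝ} (hc : 0 ≤ c)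
    (h : ∀ w ∈ L, hat (α w.1) (ratVal w.2.1 : ℝ) (1 / ((w.2.2 : ℝ) + 1)) x ≤ c) :
    maxHat α L x ≤ c := by
  induction L with
  | nil => exact hc
  | cons w L ih =>
    exact max_le (h w List.mem_cons_self) (ih fun v hv => h v (List.mem_cons_of_mem _ hv))

theorem maxHat_le_one (α : ℕ → X) (L : List (ℕ × RatCode × ℕ)) (x : X) : maxHat α L x ≤ 1 :=
  maxHat_le zero_le_one fun _ _ => hat_le_one _ _ (by positivity) _

theorem hat_le_maxHat (α : ℕ → X) {L : List (ℕ × RatCode × ℕ)} {w : ℕ × RatCode × ℕ} (hw : w ∈ L)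
    (x : X) : hat (α w.1) (ratVal w.2.1 : ℝ) (1 / ((w.2.2 : ℝ) + 1)) x ≤ maxHat α L x := by
  induction L with
  | nil => simp at hw
  | cons v L ih =>
    rcases List.mem_cons.1 hw with rfl | hw
    · exact le_max_left _ _
    · exact le_max_of_le_right (ih hw)

theorem maxHat_mono (α : ℕ → X) {L L' : List (ℕ × RatCode × ℕ)} (h : L ⊆ L') (x : X) :
    maxHat α L x ≤ maxHat α L' x :=
  maxHat_le (maxHat_nonneg _ _ _) fun _ hw => hat_le_maxHat α (h hw) x

end Hat

/-! ### Openness of the basis elements in the weak topology. -/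

section MeasureBasis

variable {X : Type*} [MetricSpace X] [MeasurableSpace X] [BorelSpace X]

theorem integrable_maxHat (α : ℕ → X) (L : List (ℕ × RatCode × ℕ)) (μ : ProbabilityMeasure X) :
    Integrable (maxHat α L) (μ : Measure X) :=
  Integrable.of_bound (continuous_maxHat α L).measurable.aestronglyMeasurable 1
    (Filter.Eventually.of_forall fun x => by
      rw [Real.norm_of_nonneg (maxHat_nonneg _ _ _)]
      exact maxHat_le_one _ _ _)

theorem continuous_integral_maxHat (α : ℕ → X) (L : List (ℕ × RatCode × ℕ)) :
    Continuous fun μ : ProbabilityMeasure X => ∫ x, maxHat α L x ∂(μ : Measure X) :=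
  ProbabilityMeasure.continuous_integral_boundedContinuousFunction
    (BoundedContinuousFunction.ofNormedAddCommGroup (maxHat α L) (continuous_maxHat α L) 1
      fun x => by
        rw [Real.norm_of_nonneg (maxHat_nonneg _ _ _)]
        exact maxHat_le_one _ _ _)

theorem isOpen_measureBasis (α : ℕ → X) (S : List (List (ℕ × RatCode × ℕ) × RatCode × Bool)) :
    IsOpen (measureBasis α S) := by
  refine S.finite_toSet.isOpen_biInter ?_
  rintro ⟨L, r, _ | _⟩ -
  · exact isOpen_lt (continuous_integral_maxHat α L) continuous_const
  · exact isOpen_lt continuous_const (continuous_integral_maxHat α L)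

end MeasureBasis

/-! ### Density and decidable comparison of coded rationals. -/

section Codes

theorem exists_posRatVal_between {a b : ℝ} (ha : 0 ≤ a) (hab : a < b) :
    ∃ q, a < posRatVal q ∧ posRatVal q < b := by
  obtain ⟨r, har, hrb⟩ := exists_rat_btwn hab
  have hr : 0 < r := by exact_mod_cast ha.trans_lt har
  have hnum : 0 < r.num := Rat.num_pos.2 hr
  have h : posRatVal (r.num.toNat - 1, r.den - 1) = (r : ℝ) := by
    have h1 : ((r.num.toNat - 1 : ℕ) : ℝ) + 1 = (r.num : ℝ) := by
      have : ((r.num.toNat - 1 : ℕ) : ℤ) + 1 = r.num := by omega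
      exact_mod_cast this
    have h2 : ((r.den - 1 : ℕ) : ℝ) + 1 = (r.den : ℝ) := by
      have := r.den_pos
      exact_mod_cast (by omega : r.den - 1 + 1 = r.den)
    simp only [posRatVal, h1, h2]
    exact (Rat.cast_def r).symm
  exact ⟨_, by rwa [h], by rwa [h]⟩

theorem exists_nnRatVal_between {a b : ℝ≥0∞} (hab : a < b) :
    ∃ q, a < (nnRatVal q : ℝ≥0∞) ∧ (nnRatVal q : ℝ≥0∞) < b := by
  obtain ⟨c, hac, hcb⟩ := ENNReal.lt_iff_exists_nnreal_btwn.1 hab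
  obtain ⟨d, hcd, hdb⟩ := ENNReal.lt_iff_exists_nnreal_btwn.1 hcb
  obtain ⟨q, h1, h2⟩ := exists_posRatVal_between c.2
    (show (c : ℝ) < d from by exact_mod_cast ENNReal.coe_lt_coe.1 hcd)
  have h : ((nnRatVal (q.1 + 1, q.2) : ℝ≥0) : ℝ) = posRatVal q := by
    simp [nnRatVal, posRatVal]
  rw [← h] at h1 h2
  refine ⟨(q.1 + 1, q.2), hac.trans (ENNReal.coe_lt_coe.2 (by exact_mod_cast h1)),
    lt_trans (ENNReal.coe_lt_coe.2 (by exact_mod_cast h2)) hdb⟩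

theorem primrecPred_nnRatVal_lt :
    PrimrecPred fun x : (ℕ × ℕ) × (ℕ × ℕ) => nnRatVal x.1 < nnRatVal x.2 := by
  have h : PrimrecPred fun x : (ℕ × ℕ) × (ℕ × ℕ) =>
      x.1.1 * (x.2.2 + 1) < x.2.1 * (x.1.2 + 1) := by
    refine Primrec.nat_lt.comp (Primrec.nat_mul.comp ?_ (Primrec.succ.comp ?_))
      (Primrec.nat_mul.comp ?_ (Primrec.succ.comp ?_))
    · exact Primrec.fst.comp Primrec.fst
    · exact Primrec.snd.comp Primrec.snd
    · exact Primrec.fst.comp Primrec.snd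
    · exact Primrec.snd.comp Primrec.fst
  refine h.of_eq fun x => ?_
  rw [nnRatVal, nnRatVal, div_lt_div_iff₀ (by positivity) (by positivity)]
  norm_cast

theorem primrecPred_ratVal_add_le :
    PrimrecPred fun x : (RatCode × ℕ) × (ℕ × ℕ) × (ℕ × ℕ) =>
      (ratVal x.1.1 : ℝ) + 1 / ((x.1.2 : ℝ) + 1) + posRatVal x.2.1 ≤ posRatVal x.2.2 := by
  have a : Primrec fun x : (RatCode × ℕ) × (ℕ × ℕ) × (ℕ × ℕ) => x.1.1.1 :=
    Primrec.fst.comp (Primrec.fst.comp Primrec.fst)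
  have b : Primrec fun x : (RatCode × ℕ) × (ℕ × ℕ) × (ℕ × ℕ) => x.1.1.2.1 :=
    Primrec.fst.comp (Primrec.snd.comp (Primrec.fst.comp Primrec.fst))
  have c : Primrec fun x : (RatCode × ℕ) × (ℕ × ℕ) × (ℕ × ℕ) => x.1.1.2.2 + 1 :=
    Primrec.succ.comp (Primrec.snd.comp (Primrec.snd.comp (Primrec.fst.comp Primrec.fst)))
  have n : Primrec fun x : (RatCode × ℕ) × (ℕ × ℕ) × (ℕ × ℕ) => x.1.2 + 1 :=
    Primrec.succ.comp (Primrec.snd.comp Primrec.fst)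
  have p : Primrec fun x : (RatCode × ℕ) × (ℕ × ℕ) × (ℕ × ℕ) => x.2.1.1 + 1 :=
    Primrec.succ.comp (Primrec.fst.comp (Primrec.fst.comp Primrec.snd))
  have q : Primrec fun x : (RatCode × ℕ) × (ℕ × ℕ) × (ℕ × ℕ) => x.2.1.2 + 1 :=
    Primrec.succ.comp (Primrec.snd.comp (Primrec.fst.comp Primrec.snd))
  have p' : Primrec fun x : (RatCode × ℕ) × (ℕ × ℕ) × (ℕ × ℕ) => x.2.2.1 + 1 :=
    Primrec.succ.comp (Primrec.fst.comp (Primrec.snd.comp Primrec.snd))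
  have q' : Primrec fun x : (RatCode × ℕ) × (ℕ × ℕ) × (ℕ × ℕ) => x.2.2.2 + 1 :=
    Primrec.succ.comp (Primrec.snd.comp (Primrec.snd.comp Primrec.snd))
  have m {f g : (RatCode × ℕ) × (ℕ × ℕ) × (ℕ × ℕ) → ℕ} (hf : Primrec f) (hg : Primrec g) :
      Primrec fun x => f x * g x := Primrec.nat_mul.comp hf hg
  have s {f g : (RatCode × ℕ) × (ℕ × ℕ) × (ℕ × ℕ) → ℕ} (hf : Primrec f) (hg : Primrec g) :
      Primrec fun x => f x + g x := Primrec.nat_add.comp hf hg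
  -- Denominators are cleared and the subtracted numerator of `ratVal` is moved to the right, so the
  -- comparison takes place in `ℕ`.
  refine (Primrec.nat_le.comp
    (m (s (m (s (m a n) c) q) (m p (m c n))) q')
    (m (s (m p' (m c n)) (m b (m n q'))) q)).of_eq fun x => ?_
  obtain ⟨⟨⟨a, b, c⟩, n⟩, ⟨p, q⟩, ⟨p', q'⟩⟩ := x
  simp only [ratVal, posRatVal]
  push_cast
  have hc : (0 : ℝ) < (c : ℝ) + 1 := by positivity
  have hn : (0 : ℝ) < (n : ℝ) + 1 := by positivity
  have hq : (0 : ℝ) < (q : ℝ) + 1 := by positivity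
  have hq' : (0 : ℝ) < (q' : ℝ) + 1 := by positivity
  rw [div_add_div _ _ hc.ne' hn.ne', div_add_div _ _ (mul_pos hc hn).ne' hq.ne',
    div_le_div_iff₀ (mul_pos (mul_pos hc hn) hq) hq', ← Nat.cast_le (α := ℝ)]
  push_cast
  constructor <;> intro h <;> linarith

end Codes

/-! ### Formal inclusion of balls, and infima over effectively compact sets. -/

section BallBasis

variable {X : Type*} [MetricSpace X]

/-- A strict inequality between computable reals is confirmed by some approximation for which it
survives adding the error bound. -/
theorem rePred_dist_add_lt {α : ℕ → X} (hα : IsComputableMetricSpace α) :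
    REPred fun x : (ℕ × (ℕ × ℕ)) × (ℕ × (ℕ × ℕ)) =>
      dist (α x.1.1) (α x.2.1) + posRatVal x.1.2 < posRatVal x.2.2 := by
  obtain ⟨g, hg, hgd⟩ := hα.computable_dist
  have hf : Computable fun y : ((ℕ × (ℕ × ℕ)) × (ℕ × (ℕ × ℕ))) × ℕ =>
      ((g ((y.1.1.1, y.1.2.1), y.2), y.2), (y.1.1.2, y.1.2.2)) := by
    refine Computable.pair (Computable.pair (hg.comp (Primrec.to_comp ?_)) Computable.snd)
      (Primrec.to_comp ?_)
    · exact ((Primrec.fst.comp (Primrec.fst.comp Primrec.fst)).pair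
        (Primrec.fst.comp (Primrec.snd.comp Primrec.fst))).pair Primrec.snd
    · exact (Primrec.snd.comp (Primrec.fst.comp Primrec.fst)).pair
        (Primrec.snd.comp (Primrec.snd.comp Primrec.fst))
  have h := (REPred.of_primrecPred primrecPred_ratVal_add_le).comp hf
  refine h.exists.of_eq fun x => ?_
  constructor
  · rintro ⟨n, hn⟩
    have := (abs_lt.1 (hgd x.1.1 x.2.1 n)).2
    dsimp only at hn
    linarith
  · intro hx
    -- Half the gap, because the error counts twice: in the approximation and in the added margin.
    obtain ⟨n, hn⟩ := exists_nat_one_div_lt (half_pos (sub_pos.2 hx))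
    have := (abs_lt.1 (hgd x.1.1 x.2.1 n)).1
    exact ⟨n, by dsimp only; linarith⟩

/-- Every point of a finite intersection of basic balls lies in a basic ball that is formally
included in all of them. -/
theorem exists_ball_formally_included {α : ℕ → X} (hα : DenseRange α)
    (L : List (ℕ × (ℕ × ℕ))) {x : X} (hx : ∀ i ∈ L, x ∈ ballBasis α i) :
    ∃ k, x ∈ ballBasis α k ∧
      ∀ i ∈ L, dist (α k.1) (α i.1) + posRatVal k.2 < posRatVal i.2 := by
  obtain ⟨δ, hδ, hδL⟩ : ∃ δ > 0, ∀ i ∈ L, dist x (α i.1) + δ ≤ posRatVal i.2 := by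
    induction L with
    | nil => exact ⟨1, one_pos, by simp⟩
    | cons i L ih =>
      obtain ⟨δ, hδ, h⟩ := ih fun j hj => hx j (List.mem_cons_of_mem _ hj)
      have hi : dist x (α i.1) < posRatVal i.2 := hx i List.mem_cons_self
      refine ⟨min δ (posRatVal i.2 - dist x (α i.1)), lt_min hδ (sub_pos.2 hi), fun j hj => ?_⟩
      rcases List.mem_cons.1 hj with rfl | hj
      · linarith [min_le_right δ (posRatVal j.2 - dist x (α j.1))]
      · linarith [min_le_left δ (posRatVal i.2 - dist x (α i.1)), h j hj]
  -- Half of the slack `δ` pays for the displacement of the center from `x`, the other half for the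
  -- radius.
  obtain ⟨r, hr, hrδ⟩ := exists_posRatVal_between le_rfl (half_pos hδ)
  obtain ⟨j, hj⟩ := hα.exists_dist_lt x hr
  refine ⟨(j, r), hj, fun i hi => ?_⟩
  have h1 := dist_triangle_left (α j) (α i.1) x
  have h2 := hδL i hi
  dsimp only
  linarith

/-- Inclusion is certified by this inequality between centers and radii, which is semidecidable by
`rePred_dist_add_lt`. -/
theorem ballBasis_subset {α : ℕ → X} {k i : ℕ × (ℕ × ℕ)}
    (h : dist (α k.1) (α i.1) + posRatVal k.2 < posRatVal i.2) :
    ballBasis α k ⊆ ballBasis α i :=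
  Metric.ball_subset_ball' (by linarith)

/-- The infimum of a lower semicomputable function over an effectively compact set of parameters is
lower semicomputable. -/
theorem LowerSemicomputable.iInf_of_effectivelyCompact {κ Z : Type*} [TopologicalSpace Z]
    [Primcodable κ] {α : ℕ → X} (hα : IsComputableMetricSpace α) {B : κ → Set Z}
    (hB : ∀ i, IsOpen (B i)) {C : Set Z} (hC : EffectivelyCompact B C) {t : X × Z → ℝ≥0∞}
    (ht : LowerSemicomputable (prodBasis (ballBasis α) B) t) :
    LowerSemicomputable (ballBasis α) fun x => ⨅ z ∈ C, t (x, z) := by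
  obtain ⟨p, hp, hpt⟩ := ht
  obtain ⟨hCc, hCr⟩ := hC
  have hpt' (q x z) : (nnRatVal q : ℝ≥0∞) < t (x, z) ↔
      ∃ l : (ℕ × (ℕ × ℕ)) × κ, p (q, l) ∧ x ∈ ballBasis α l.1 ∧ z ∈ B l.2 := by
    have := Set.ext_iff.1 (hpt q) (x, z)
    simp only [Set.mem_ofPred_eq, Set.mem_iUnion, exists_prop] at this
    exact this
  -- The threshold `q` and the output ball, followed by the certificate: a larger threshold `q'` and
  -- a finite list of basic products.
  let Y := ((ℕ × ℕ) × (ℕ × (ℕ × ℕ))) × ((ℕ × ℕ) × List ((ℕ × (ℕ × ℕ)) × κ))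
  have hL : Primrec fun y : Y => y.2.2 := Primrec.snd.comp Primrec.snd
  have f1 : Computable fun y : Y => (y.1.1, y.2.1) :=
    ((Primrec.fst.comp Primrec.fst).pair (Primrec.fst.comp Primrec.snd)).to_comp
  have f3 : Computable fun y : Y => y.2.2.map Prod.snd :=
    (Primrec.list_map hL (Primrec.snd.comp Primrec.snd).to₂).to_comp
  have f4 : Computable fun y : Y => (y.1.2, y.2.2.map Prod.fst) :=
    ((Primrec.snd.comp Primrec.fst).pair
      (Primrec.list_map hL (Primrec.fst.comp Primrec.snd).to₂)).to_comp
  have h1 := (REPred.of_primrecPred primrecPred_nnRatVal_lt).comp f1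
  have h2 := hp.forall_mem_list.comp (Computable.snd : Computable fun y : Y => y.2)
  have h3 := hCr.comp f3
  have h4 := (rePred_dist_add_lt hα).forall_mem_list.comp f4
  refine ⟨_, (h1.and (h2.and (h3.and h4))).exists, fun q => ?_⟩
  ext x
  simp only [Set.mem_ofPred_eq, Set.mem_iUnion, exists_prop]
  constructor
  · intro hx
    -- A cover by sets on which `t > q'` only gives `q' ≤ u x`; the gap between `q` and `q'`
    -- restores strictness.
    obtain ⟨q', hq, hq'⟩ := exists_nnRatVal_between hx
    obtain ⟨F, hF⟩ := hCc.elim_finite_subcover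
      (fun l : {l : (ℕ × (ℕ × ℕ)) × κ // p (q', l) ∧ x ∈ ballBasis α l.1} => B l.1.2)
      (fun l => hB _) fun z hz => by
        obtain ⟨l, hl, hxl, hzl⟩ := (hpt' q' x z).1 (hq'.trans_le (iInf₂_le z hz))
        exact Set.mem_iUnion.2 ⟨⟨l, hl, hxl⟩, hzl⟩
    let L := F.toList.map Subtype.val
    have hL : ∀ l ∈ L, p (q', l) ∧ x ∈ ballBasis α l.1 := by
      intro l hl
      obtain ⟨l, -, rfl⟩ := List.mem_map.1 hl
      exact l.2
    obtain ⟨k, hxk, hk⟩ := exists_ball_formally_included hα.dense (L.map Prod.fst) (x := x) (by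
      intro i hi
      obtain ⟨l, hl, rfl⟩ := List.mem_map.1 hi
      exact (hL l hl).2)
    refine ⟨k, ⟨(q', L), ENNReal.coe_lt_coe.1 hq, fun l hl => (hL l hl).1, fun z hz => ?_, hk⟩, hxk⟩
    obtain ⟨l, hl, hzl⟩ := Set.mem_iUnion₂.1 (hF hz)
    exact Set.mem_iUnion₂.2 ⟨l.1.2, List.mem_map_of_mem
      (List.mem_map_of_mem (Finset.mem_toList.2 hl)), hzl⟩
  · rintro ⟨k, ⟨⟨q', L⟩, hq, hL, hCL, hk⟩, hxk⟩
    refine (ENNReal.coe_lt_coe.2 hq).trans_le (le_iInf₂ fun z hz => ?_)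
    obtain ⟨i, hi, hzi⟩ := Set.mem_iUnion₂.1 (hCL hz)
    obtain ⟨l, hl, rfl⟩ := List.mem_map.1 hi
    exact ((hpt' q' x z).2 ⟨l, hL l hl,
      ballBasis_subset (hk l.1 (List.mem_map_of_mem hl)) hxk, hzi⟩).le

end BallBasis

/-- A level together with a basic ball and an index of the width of the hat function around it. -/
abbrev LevelBall : Type := ℕ × (ℕ × (ℕ × ℕ)) × ℕ

/-- The code of the hat function that is `1` on the ball of `w`. -/
def hatCode (w : LevelBall) : ℕ × RatCode × ℕ :=
  (w.2.1.1, (w.2.1.2.1 + 1, 0, w.2.1.2.2), w.2.2)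

/-- The hat functions of the elements of `l` of level at least `k`. -/
def levelHats (l : List LevelBall) (k : ℕ) : List (ℕ × RatCode × ℕ) :=
  (l.filter fun w => k ≤ w.1).map hatCode

/-- The first `n` layers of the `n`-th stage of an enumeration. -/
def layers (W : ℕ → List LevelBall) (n : ℕ) : List (List (ℕ × RatCode × ℕ)) :=
  (List.range n).map (levelHats (W n))

/-- The basis element of the space of measures given by strict upper bounds `a / (D + 1)` on
the integrals of finitely many maxima of hat functions. -/
def upperBoundsCode (D : ℕ) (T : List (List (ℕ × RatCode × ℕ) × ℕ)) :
    List (List (ℕ × RatCode × ℕ) × RatCode × Bool) :=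
  T.map fun y => (y.1, (y.2, 0, D), false)

/-! ### Primitive recursiveness of the layer codes. -/

section Primrec

theorem primrec_levelHats {W : ℕ → List LevelBall} (hW : Primrec W) :
    Primrec₂ fun n k => levelHats (W n) k := by
  have hle : PrimrecRel fun (w : LevelBall) (k : ℕ) => k ≤ w.1 :=
    Primrec.nat_le.comp Primrec.snd (Primrec.fst.comp Primrec.fst)
  have hcode : Primrec hatCode := by
    have h : Primrec fun w : LevelBall => w.2.1 := Primrec.fst.comp Primrec.snd
    exact (Primrec.fst.comp h).pair (((Primrec.succ.comp (Primrec.fst.comp (Primrec.snd.comp h))).pair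
      ((Primrec.const 0).pair (Primrec.snd.comp (Primrec.snd.comp h)))).pair
        (Primrec.snd.comp Primrec.snd))
  have hf : Primrec₂ fun n k => (W n).filter fun w => k ≤ w.1 :=
    hle.listFilter.comp (hW.comp Primrec.fst) Primrec.snd
  exact Primrec.list_map hf (hcode.comp Primrec.snd).to₂

theorem primrec_layers {W : ℕ → List LevelBall} (hW : Primrec W) : Primrec (layers W) :=
  Primrec.list_map Primrec.list_range (primrec_levelHats hW)

theorem primrec_upperBoundsCode : Primrec₂ upperBoundsCode := by
  have h : Primrec₂ fun (x : ℕ × List (List (ℕ × RatCode × ℕ) × ℕ))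
      (y : List (ℕ × RatCode × ℕ) × ℕ) =>
        ((y.1, (y.2, 0, x.1), false) : List (ℕ × RatCode × ℕ) × RatCode × Bool) :=
    (Primrec.fst.comp Primrec.snd).pair (((Primrec.snd.comp Primrec.snd).pair
      ((Primrec.const 0).pair (Primrec.fst.comp Primrec.fst))).pair (Primrec.const false))
  exact Primrec.list_map Primrec.snd h

theorem primrec_list_sum : Primrec (List.sum : List ℕ → ℕ) :=
  (Primrec.list_foldr Primrec.id (Primrec.const 0)
    (Primrec.nat_add.comp (Primrec.fst.comp Primrec.snd)
      (Primrec.snd.comp Primrec.snd)).to₂).of_eq fun l => by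
    induction l with
    | nil => rfl
    | cons a l ih => simpa using ih

end Primrec

/-! ### Finite certificates for upper bounds on sums of integrals. -/

section UpperBounds

variable {X : Type*} [MetricSpace X] [MeasurableSpace X] {α : ℕ → X}

theorem mem_measureBasis_upperBoundsCode {D : ℕ} {T : List (List (ℕ × RatCode × ℕ) × ℕ)}
    {μ : ProbabilityMeasure X} :
    μ ∈ measureBasis α (upperBoundsCode D T) ↔
      ∀ y ∈ T, ∫ x, maxHat α y.1 x ∂(μ : Measure X) < (y.2 : ℝ) / ((D : ℝ) + 1) := by
  rw [measureBasis, Set.mem_iInter₂]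
  unfold upperBoundsCode
  rw [List.forall_mem_map]
  simp [measureSubbasis, ratVal]

theorem sum_integral_le_of_mem_measureBasis {D : ℕ} {T : List (List (ℕ × RatCode × ℕ) × ℕ)}
    {μ : ProbabilityMeasure X} (h : μ ∈ measureBasis α (upperBoundsCode D T)) :
    ((T.map Prod.fst).map fun L => ∫ x, maxHat α L x ∂(μ : Measure X)).sum ≤
      ((T.map Prod.snd).sum : ℝ) / ((D : ℝ) + 1) := by
  rw [mem_measureBasis_upperBoundsCode] at h
  induction T with
  | nil => simp
  | cons y T ih =>
    have h1 := ih fun z hz => h z (List.mem_cons_of_mem _ hz)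
    have h2 := h y List.mem_cons_self
    simp only [List.map_cons, List.sum_cons, Nat.cast_add, add_div]
    linarith

/-- With `sum_integral_le_of_mem_measureBasis`, this expresses a strict bound on a sum of integrals
as a union of basis elements, each of which bounds the summands separately. -/
theorem exists_mem_measureBasis_of_sum_integral_lt {Ls : List (List (ℕ × RatCode × ℕ))} {c : ℕ}
    {μ : ProbabilityMeasure X}
    (h : (Ls.map fun L => ∫ x, maxHat α L x ∂(μ : Measure X)).sum < c) :
    ∃ D T, T.map Prod.fst = Ls ∧ (T.map Prod.snd).sum < c * (D + 1) ∧
      μ ∈ measureBasis α (upperBoundsCode D T) := by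
  obtain ⟨D, hD⟩ := exists_nat_gt ((Ls.length : ℝ) /
    (c - (Ls.map fun L => ∫ x, maxHat α L x ∂(μ : Measure X)).sum))
  rw [div_lt_iff₀ (sub_pos.2 h)] at hD
  have hnn (L : List (ℕ × RatCode × ℕ)) : 0 ≤ ∫ x, maxHat α L x ∂(μ : Measure X) :=
    integral_nonneg fun x => maxHat_nonneg α L x
  have hD0 : (0 : ℝ) < (D : ℝ) + 1 := by positivity
  -- Each integral is rounded up strictly to a multiple of `1 / (D + 1)`; `D` is large enough for
  -- the total rounding error to stay below the slack.
  refine ⟨D, Ls.map fun L =>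
    (L, ⌊(∫ x, maxHat α L x ∂(μ : Measure X)) * ((D : ℝ) + 1)⌋₊ + 1), ?_, ?_, ?_⟩
  · simp [Function.comp_def]
  · have hsum : (((Ls.map fun L =>
        ⌊(∫ x, maxHat α L x ∂(μ : Measure X)) * ((D : ℝ) + 1)⌋₊ + 1).sum : ℕ) : ℝ) ≤
        (Ls.map fun L => ∫ x, maxHat α L x ∂(μ : Measure X)).sum * ((D : ℝ) + 1) + Ls.length := by
      clear h hD
      induction Ls with
      | nil => simp
      | cons L Ls ih =>
        have := Nat.floor_le (mul_nonneg (hnn L) hD0.le)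
        simp only [List.map_cons, List.sum_cons, List.length_cons]
        push_cast at ih ⊢
        linarith
    rw [List.map_map, ← Nat.cast_lt (α := ℝ)]
    refine lt_of_le_of_lt hsum ?_
    push_cast
    nlinarith
  · rw [mem_measureBasis_upperBoundsCode]
    intro y hy
    obtain ⟨L, -, rfl⟩ := List.mem_map.1 hy
    rw [lt_div_iff₀ hD0]
    push_cast
    exact Nat.lt_floor_add_one _

end UpperBounds

/-! ### The layer count and the trimmed uniform test. -/

section TrimmedTest

variable {X : Type*} [MetricSpace X]

/-- The approximation from below to `x ↦ #{k | x ∈ U k}` that the `n`-th stage of an enumeration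
gives, where `U k` is the union of the enumerated balls of level at least `k`. -/
noncomputable def layerSum (α : ℕ → X) (W : ℕ → List LevelBall) (n : ℕ) (x : X) : ℝ :=
  ∑ k ∈ Finset.range n, maxHat α (levelHats (W n) k) x

theorem continuous_layerSum (α : ℕ → X) (W : ℕ → List LevelBall) (n : ℕ) :
    Continuous (layerSum α W n) :=
  continuous_finsetSum _ fun _ _ => continuous_maxHat _ _

theorem layerSum_nonneg (α : ℕ → X) (W : ℕ → List LevelBall) (n : ℕ) (x : X) :
    0 ≤ layerSum α W n x :=
  Finset.sum_nonneg fun _ _ => maxHat_nonneg _ _ _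

theorem layerSum_mono (α : ℕ → X) {W : ℕ → List LevelBall} (hW : ∀ m n, m ≤ n → W m ⊆ W n)
    {m n : ℕ} (hmn : m ≤ n) (x : X) : layerSum α W m x ≤ layerSum α W n x := by
  refine (Finset.sum_le_sum fun k _ => maxHat_mono α (L' := levelHats (W n) k) ?_ x).trans
    (Finset.sum_le_sum_of_subset_of_nonneg (Finset.range_mono hmn)
      fun _ _ _ => maxHat_nonneg _ _ _)
  exact List.map_subset _ (List.filter_subset _ (hW m n hmn))

theorem hat_hatCode_eq_one {α : ℕ → X} {w : LevelBall} {x : X} (h : x ∈ ballBasis α w.2.1) :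
    hat (α (hatCode w).1) (ratVal (hatCode w).2.1 : ℝ) (1 / (((hatCode w).2.2 : ℝ) + 1)) x = 1 := by
  refine hat_eq_one ?_
  have h' : dist x (α w.2.1.1) < posRatVal w.2.1.2 := h
  simpa [hatCode, ratVal, posRatVal] using h'.le

theorem hat_hatCode_eq_zero {α : ℕ → X} {w : LevelBall} {x : X}
    (h : posRatVal w.2.1.2 + 1 / ((w.2.2 : ℝ) + 1) ≤ dist x (α w.2.1.1)) :
    hat (α (hatCode w).1) (ratVal (hatCode w).2.1 : ℝ) (1 / (((hatCode w).2.2 : ℝ) + 1)) x = 0 := by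
  refine hat_eq_zero (by positivity) ?_
  simpa [hatCode, ratVal, posRatVal] using h

/-- A ball of level `w.1` belongs to the `w.1 + 1` layers `0, …, w.1`, each of which equals 1 on it;
`w.1 < n` ensures that stage `n` counts them all. -/
theorem le_layerSum {α : ℕ → X} {W : ℕ → List LevelBall} {n : ℕ} {w : LevelBall} (hw : w ∈ W n)
    (hwn : w.1 < n) {x : X} (hx : x ∈ ballBasis α w.2.1) : (w.1 : ℝ) + 1 ≤ layerSum α W n x := by
  calc (w.1 : ℝ) + 1 = ∑ k ∈ Finset.range (w.1 + 1), (1 : ℝ) := by simp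
    _ ≤ ∑ k ∈ Finset.range (w.1 + 1), maxHat α (levelHats (W n) k) x := by
      refine Finset.sum_le_sum fun k hk => ?_
      rw [← hat_hatCode_eq_one hx]
      refine hat_le_maxHat α (List.mem_map_of_mem (List.mem_filter.2 ⟨hw, ?_⟩)) x
      simpa using Nat.lt_succ_iff.1 (Finset.mem_range.1 hk)
    _ ≤ layerSum α W n x :=
      Finset.sum_le_sum_of_subset_of_nonneg (Finset.range_mono hwn)
        fun _ _ _ => maxHat_nonneg _ _ _

/-- If the hat functions of level `k` vanish at `x` unless `k < a`, then the sum of the layers at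
`x` is at most `a + 1`. -/
theorem layerSum_le {α : ℕ → X} {W : ℕ → List LevelBall} {n : ℕ} {x : X} {a : ℝ} (ha : 0 ≤ a)
    (h : ∀ w ∈ W n, a ≤ w.1 →
      hat (α (hatCode w).1) (ratVal (hatCode w).2.1 : ℝ) (1 / (((hatCode w).2.2 : ℝ) + 1)) x = 0) :
    layerSum α W n x ≤ a + 1 := by
  have hk : ∀ k : ℕ, a ≤ k → maxHat α (levelHats (W n) k) x = 0 := by
    refine fun k hk => le_antisymm (maxHat_le le_rfl fun v hv => ?_) (maxHat_nonneg _ _ _)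
    obtain ⟨w, hw, rfl⟩ := List.mem_map.1 hv
    obtain ⟨hw, hkw⟩ := List.mem_filter.1 hw
    have hkw : k ≤ w.1 := by simpa using hkw
    exact (h w hw (hk.trans (by exact_mod_cast hkw))).le
  -- The trivial bound `m` is carried along to handle the layers below `a`; later layers vanish.
  suffices H : ∀ m : ℕ, (∑ k ∈ Finset.range m, maxHat α (levelHats (W n) k) x ≤ a + 1) ∧
      ∑ k ∈ Finset.range m, maxHat α (levelHats (W n) k) x ≤ m from (H n).1
  intro m
  induction m with
  | zero => simpa using by linarith
  | succ m ih =>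
    rw [Finset.sum_range_succ]
    have h1 := maxHat_le_one α (levelHats (W n) m) x
    push_cast
    rcases le_or_gt a m with ham | ham
    · rw [hk m ham]
      exact ⟨by linarith, by linarith⟩
    · exact ⟨by linarith, by linarith⟩

/-- A lower semicomputable function is given by an increasing primitive recursive sequence of finite
lists of balls with hat functions that vanish outside of the superlevel sets. -/
theorem LowerSemicomputable.exists_levelBalls {α : ℕ → X} {f : X → ℝ≥0∞}
    (hf : LowerSemicomputable (ballBasis α) f) :
    ∃ W : ℕ → List LevelBall, Primrec W ∧ (∀ m n, m ≤ n → W m ⊆ W n) ∧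
      (∀ n, ∀ w ∈ W n, ∀ x, f x ≤ w.1 →
        posRatVal w.2.1.2 + 1 / ((w.2.2 : ℝ) + 1) ≤ dist x (α w.2.1.1)) ∧
      ∀ (k : ℕ) (x : X), k < f x → ∃ n, ∃ w ∈ W n, w.1 = k ∧ x ∈ ballBasis α w.2.1 := by
  obtain ⟨p, hp, hpf⟩ := hf
  have hpf' (k : ℕ) (x : X) : (k : ℝ≥0∞) < f x ↔ ∃ i, p ((k, 0), i) ∧ x ∈ ballBasis α i := by
    have := Set.ext_iff.1 (hpf (k, 0)) x
    simp only [Set.mem_ofPred_eq, Set.mem_iUnion, exists_prop] at this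
    rw [← this]
    simp [nnRatVal]
  -- A level ball is accepted if a concentric ball of some radius `r` is enumerated into its
  -- superlevel set and `r` is at least its own radius plus the width of the hat.
  have f1 : Computable fun y : LevelBall × (ℕ × ℕ) => ((y.1.1, 0), (y.1.2.1.1, y.2)) :=
    (((Primrec.fst.comp Primrec.fst).pair (Primrec.const 0)).pair
      ((Primrec.fst.comp (Primrec.fst.comp (Primrec.snd.comp Primrec.fst))).pair
        Primrec.snd)).to_comp
  have f2 : Primrec fun y : LevelBall × (ℕ × ℕ) =>
      ((((0, 0, 0) : RatCode), y.1.2.2), (y.1.2.1.2, y.2)) :=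
    ((Primrec.const _).pair (Primrec.snd.comp (Primrec.snd.comp Primrec.fst))).pair
      ((Primrec.snd.comp (Primrec.fst.comp (Primrec.snd.comp Primrec.fst))).pair Primrec.snd)
  obtain ⟨W, hW, hWm, hWp⟩ := ((hp.comp f1).and
    (REPred.of_primrecPred (primrecPred_ratVal_add_le.comp f2))).exists.exists_stages
  have hr : ratVal (0, 0, 0) = 0 := by simp [ratVal]
  simp only [hr, Rat.cast_zero, zero_add] at hWp
  refine ⟨W, hW, hWm, fun n w hw x hx => ?_, fun k x hkx => ?_⟩
  · obtain ⟨r, hr, hrw⟩ := (hWp w).2 ⟨n, hw⟩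
    by_contra! h
    refine hx.not_gt ((hpf' w.1 x).2 ⟨_, hr, ?_⟩)
    change dist x (α w.2.1.1) < posRatVal r
    linarith
  · obtain ⟨⟨u, r⟩, hp, hx⟩ := (hpf' k x).1 hkx
    have hx : dist x (α u) < posRatVal r := hx
    -- Shrinking the radius leaves room for the sloping part of the hat.
    obtain ⟨r', hr', hr'r⟩ := exists_posRatVal_between dist_nonneg hx
    obtain ⟨m, hm⟩ := exists_nat_one_div_lt (sub_pos.2 hr'r)
    obtain ⟨n, hn⟩ := (hWp (k, (u, r'), m)).1 ⟨r, hp, by dsimp only; linarith⟩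
    exact ⟨n, _, hn, rfl, hr'⟩

variable [MeasurableSpace X] [BorelSpace X]

theorem integrable_layerSum (α : ℕ → X) (W : ℕ → List LevelBall) (n : ℕ)
    (μ : ProbabilityMeasure X) : Integrable (layerSum α W n) (μ : Measure X) :=
  integrable_finsetSum _ fun _ _ => integrable_maxHat _ _ _

theorem integral_layerSum (α : ℕ → X) (W : ℕ → List LevelBall) (n : ℕ)
    (μ : ProbabilityMeasure X) :
    ∫ x, layerSum α W n x ∂(μ : Measure X) =
      ((layers W n).map fun L => ∫ x, maxHat α L x ∂(μ : Measure X)).sum := by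
  unfold layerSum
  rw [integral_finsetSum _ fun _ _ => integrable_maxHat _ _ _, layers, List.map_map]
  rfl

/-- The test that counts the layers of a point as long as the integral of the count is less
than `3`, divided by `3`. -/
noncomputable def trimmedTest (α : ℕ → X) (W : ℕ → List LevelBall)
    (y : X × ProbabilityMeasure X) : ℝ≥0∞ :=
  -- The values are the constants `(w.1 + 1) / 3` on balls, not `layerSum / 3`, so superlevel sets
  -- are directly unions of basic products.
  ⨆ (n : ℕ) (_ : ∫ x, layerSum α W n x ∂(y.2 : Measure X) < 3) (w : LevelBall)
    (_ : w ∈ W n ∧ w.1 < n ∧ y.1 ∈ ballBasis α w.2.1), (nnRatVal (w.1 + 1, 2) : ℝ≥0∞)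

/-- The certificate `(n, w, D, T)` is checked by primitive recursive conditions; `x` and `μ` enter
only through membership in basis elements, as lower semicomputability demands. -/
theorem lt_trimmedTest_iff (α : ℕ → X) (W : ℕ → List LevelBall) (q : ℕ × ℕ) (x : X)
    (μ : ProbabilityMeasure X) :
    (nnRatVal q : ℝ≥0∞) < trimmedTest α W (x, μ) ↔
      ∃ n w D T, w ∈ W n ∧ w.1 < n ∧ nnRatVal q < nnRatVal (w.1 + 1, 2) ∧
        T.map Prod.fst = layers W n ∧ (T.map Prod.snd).sum < 3 * (D + 1) ∧
        x ∈ ballBasis α w.2.1 ∧ μ ∈ measureBasis α (upperBoundsCode D T) := by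
  simp only [trimmedTest, lt_iSup_iff, ENNReal.coe_lt_coe, exists_prop]
  constructor
  · rintro ⟨n, hn, w, ⟨hw, hwn, hx⟩, hq⟩
    rw [integral_layerSum] at hn
    obtain ⟨D, T, hT, hs, hμ⟩ := exists_mem_measureBasis_of_sum_integral_lt (α := α)
      (Ls := layers W n) (c := 3) (μ := μ) (by exact_mod_cast hn)
    exact ⟨n, w, D, T, hw, hwn, hq, hT, hs, hx, hμ⟩
  · rintro ⟨n, w, D, T, hw, hwn, hq, hT, hs, hx, hμ⟩
    refine ⟨n, ?_, w, ⟨hw, hwn, hx⟩, hq⟩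
    rw [integral_layerSum, ← hT]
    refine (sum_integral_le_of_mem_measureBasis hμ).trans_lt ?_
    rw [div_lt_iff₀ (by positivity)]
    exact_mod_cast hs

theorem lowerSemicomputable_trimmedTest (α : ℕ → X) {W : ℕ → List LevelBall} (hW : Primrec W) :
    LowerSemicomputable (prodBasis (ballBasis α) (measureBasis α)) (trimmedTest α W) := by
  let Y := ((ℕ × ℕ) × ((ℕ × (ℕ × ℕ)) × List (List (ℕ × RatCode × ℕ) × RatCode × Bool))) ×
    ((ℕ × LevelBall) × (ℕ × List (List (ℕ × RatCode × ℕ) × ℕ)))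
  have hn : Primrec fun y : Y => y.2.1.1 := Primrec.fst.comp (Primrec.fst.comp Primrec.snd)
  have hw : Primrec fun y : Y => y.2.1.2 := Primrec.snd.comp (Primrec.fst.comp Primrec.snd)
  have hD : Primrec fun y : Y => y.2.2.1 := Primrec.fst.comp (Primrec.snd.comp Primrec.snd)
  have hT : Primrec fun y : Y => y.2.2.2 := Primrec.snd.comp (Primrec.snd.comp Primrec.snd)
  have h1 : PrimrecPred fun y : Y => y.2.1.2 ∈ W y.2.1.1 :=
    (Primrec.eq.exists_mem_list.comp (hW.comp hn) hw).of_eq fun y => by simp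
  have h2 : PrimrecPred fun y : Y => y.2.1.2.1 < y.2.1.1 :=
    Primrec.nat_lt.comp (Primrec.fst.comp hw) hn
  have h3 : PrimrecPred fun y : Y => y.1.2.1 = y.2.1.2.2.1 :=
    Primrec.eq.comp (Primrec.fst.comp (Primrec.snd.comp Primrec.fst))
      (Primrec.fst.comp (Primrec.snd.comp hw))
  have f4 : Primrec fun y : Y => (y.1.1, (y.2.1.2.1 + 1, 2)) :=
    (Primrec.fst.comp Primrec.fst).pair
      ((Primrec.succ.comp (Primrec.fst.comp hw)).pair (Primrec.const 2))
  have h4 := primrecPred_nnRatVal_lt.comp f4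
  have h5 : PrimrecPred fun y : Y => y.2.2.2.map Prod.fst = layers W y.2.1.1 :=
    Primrec.eq.comp (Primrec.list_map hT (Primrec.fst.comp Primrec.snd).to₂)
      ((primrec_layers hW).comp hn)
  have h6 : PrimrecPred fun y : Y => (y.2.2.2.map Prod.snd).sum < 3 * (y.2.2.1 + 1) :=
    Primrec.nat_lt.comp
      (primrec_list_sum.comp (Primrec.list_map hT (Primrec.snd.comp Primrec.snd).to₂))
      (Primrec.nat_mul.comp (Primrec.const 3) (Primrec.succ.comp hD))
  have h7 : PrimrecPred fun y : Y => y.1.2.2 = upperBoundsCode y.2.2.1 y.2.2.2 :=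
    Primrec.eq.comp (Primrec.snd.comp (Primrec.snd.comp Primrec.fst))
      (primrec_upperBoundsCode.comp hD hT)
  have h := (REPred.of_primrecPred
    (h1.and (h2.and (h3.and (h4.and (h5.and (h6.and h7))))))).exists
  refine ⟨_, h, fun q => ?_⟩
  ext ⟨x, μ⟩
  rw [Set.mem_ofPred_eq, lt_trimmedTest_iff, Set.mem_iUnion₂]
  constructor
  · rintro ⟨n, w, D, T, hw, hwn, hq, hT, hs, hx, hμ⟩
    exact ⟨(w.2.1, upperBoundsCode D T), ⟨((n, w), (D, T)), hw, hwn, rfl, hq, hT, hs, rfl⟩, hx, hμ⟩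
  · rintro ⟨⟨i, S⟩, ⟨⟨⟨n, w⟩, ⟨D, T⟩⟩, hw, hwn, hi, hq, hT, hs, hS⟩, hx, hμ⟩
    dsimp only at hi hS
    subst hi hS
    exact ⟨n, w, D, T, hw, hwn, hq, hT, hs, hx, hμ⟩

/-- The test lies below the supremum of the admitted functions `layerSum / 3`, each of integral at
most 1; monotone convergence passes this bound to the supremum. -/
theorem lintegral_trimmedTest_le (α : ℕ → X) {W : ℕ → List LevelBall}
    (hW : ∀ m n, m ≤ n → W m ⊆ W n) (μ : ProbabilityMeasure X) :
    ∫⁻ x, trimmedTest α W (x, μ) ∂(μ : Measure X) ≤ 1 := by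
  classical
  let ψ : ℕ → X → ℝ≥0∞ := fun n x =>
    if ∫ x, layerSum α W n x ∂(μ : Measure X) < 3 then ENNReal.ofReal (layerSum α W n x / 3) else 0
  have hψ : ∀ n, Measurable (ψ n) := by
    intro n
    by_cases h : ∫ x, layerSum α W n x ∂(μ : Measure X) < 3
    · simp only [ψ, if_pos h]
      exact ((continuous_layerSum α W n).measurable.div_const 3).ennreal_ofReal
    · simp only [ψ, if_neg h]
      exact measurable_const
  have hle : ∀ x, trimmedTest α W (x, μ) ≤ ⨆ n, ψ n x := by
    refine fun x => iSup_le fun n => iSup_le fun hn => iSup₂_le fun w hw => le_iSup_of_le n ?_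
    simp only [ψ, if_pos hn]
    rw [← ENNReal.ofReal_coe_nnreal]
    refine ENNReal.ofReal_le_ofReal ?_
    have := le_layerSum hw.1 hw.2.1 hw.2.2
    simp only [nnRatVal]
    push_cast
    linarith
  -- `ψ` need not be monotone, since rejected stages are replaced by 0; but the larger of two
  -- admitted stages is admitted and dominates both.
  have hdir : Directed (· ≤ ·) ψ := by
    intro m n
    by_cases hm : ∫ x, layerSum α W m x ∂(μ : Measure X) < 3
    · by_cases hn : ∫ x, layerSum α W n x ∂(μ : Measure X) < 3
      · have hmax : ∫ x, layerSum α W (max m n) x ∂(μ : Measure X) < 3 := by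
          rcases max_choice m n with h | h <;> rwa [h]
        refine ⟨max m n, fun x => ?_, fun x => ?_⟩
        · simp only [ψ, if_pos hm, if_pos hmax]
          exact ENNReal.ofReal_le_ofReal (div_le_div_of_nonneg_right
            (layerSum_mono α hW (le_max_left m n) x) (by norm_num))
        · simp only [ψ, if_pos hn, if_pos hmax]
          exact ENNReal.ofReal_le_ofReal (div_le_div_of_nonneg_right
            (layerSum_mono α hW (le_max_right m n) x) (by norm_num))
      · exact ⟨m, le_rfl, fun x => by simp [ψ, hn]⟩
    · exact ⟨n, fun x => by simp [ψ, hm], le_rfl⟩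
  refine (lintegral_mono hle).trans ?_
  rw [lintegral_iSup_directed (fun n => (hψ n).aemeasurable) hdir]
  refine iSup_le fun n => ?_
  by_cases h : ∫ x, layerSum α W n x ∂(μ : Measure X) < 3
  · simp only [ψ, if_pos h]
    rw [← ofReal_integral_eq_lintegral_ofReal ((integrable_layerSum α W n μ).div_const 3)
      (Filter.Eventually.of_forall fun x => div_nonneg (layerSum_nonneg α W n x) (by norm_num)),
      integral_div, ENNReal.ofReal_le_one]
    linarith
  · simp [ψ, h]

theorem isUniformTest_trimmedTest (α : ℕ → X) {W : ℕ → List LevelBall} (hW : Primrec W)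
    (hWm : ∀ m n, m ≤ n → W m ⊆ W n) : IsUniformTest α (trimmedTest α W) :=
  ⟨lowerSemicomputable_trimmedTest α hW, lintegral_trimmedTest_le α hWm⟩

/-- A lower semicomputable function of integral at most one for all measures in `C` is dominated
by a uniform test on `C`. -/
theorem IsClassTest.exists_isUniformTest {α : ℕ → X} {C : Set (ProbabilityMeasure X)}
    {f : X → ℝ≥0∞} (hf : IsClassTest α C f) :
    ∃ s : X × ProbabilityMeasure X → ℝ≥0∞, IsUniformTest α s ∧
      ∀ x, ∀ μ ∈ C, f x ≤ 3 * s (x, μ) := by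
  obtain ⟨W, hW, hWm, hzero, hball⟩ := hf.lowerSemicomputable.exists_levelBalls
  refine ⟨trimmedTest α W, isUniformTest_trimmedTest α hW hWm, fun x μ hμ => ?_⟩
  -- Hats of level at least `f x` vanish at `x`, so about `f x` layers remain, and rounding costs at
  -- most 1.
  have hsum (n : ℕ) (x : X) : ENNReal.ofReal (layerSum α W n x) ≤ f x + 1 := by
    by_cases hx : f x = ⊤
    · simp [hx]
    · have h := layerSum_le (α := α) (W := W) (n := n) (x := x) (a := (f x).toReal)
        ENNReal.toReal_nonneg fun w hw hxw => hat_hatCode_eq_zero (hzero n w hw x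
          ((ENNReal.le_ofReal_iff_toReal_le hx (Nat.cast_nonneg _)).2 hxw |>.trans (by simp)))
      refine (ENNReal.ofReal_le_ofReal h).trans ?_
      rw [ENNReal.ofReal_add ENNReal.toReal_nonneg zero_le_one, ENNReal.ofReal_toReal hx,
        ENNReal.ofReal_one]
  -- The integral is at most `1 + 1 = 2`, so every stage is admitted for `μ ∈ C`.
  have hint (n : ℕ) : ∫ x, layerSum α W n x ∂(μ : Measure X) < 3 := by
    have h : ENNReal.ofReal (∫ x, layerSum α W n x ∂(μ : Measure X)) ≤ 2 := by
      rw [ofReal_integral_eq_lintegral_ofReal (integrable_layerSum α W n μ)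
        (Filter.Eventually.of_forall fun x => layerSum_nonneg α W n x)]
      refine (lintegral_mono (hsum n)).trans ?_
      rw [lintegral_add_right _ measurable_const, lintegral_const, measure_univ, one_mul,
        ← one_add_one_eq_two]
      gcongr
      exact hf.lintegral_le μ hμ
    have := (ENNReal.ofReal_le_iff_le_toReal (by simp)).1 h
    simp only [ENNReal.toReal_ofNat] at this
    linarith
  refine le_of_forall_lt fun c hc => ?_
  lift c to ℝ≥0 using hc.ne_top
  -- A ball of level `⌊c⌋₊` around `x` makes three times the test at least `⌊c⌋₊ + 1 > c`.
  have hk : ((⌊c⌋₊ : ℕ) : ℝ≥0∞) < f x :=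
    lt_of_le_of_lt (by exact_mod_cast Nat.floor_le (zero_le (a := c))) hc
  obtain ⟨n, w, hw, hwk, hx⟩ := hball _ x hk
  -- A later stage is used so that its index also exceeds the level of `w`.
  have hw' := hWm n (max n (w.1 + 1)) (le_max_left _ _) hw
  have hs : (nnRatVal (w.1 + 1, 2) : ℝ≥0∞) ≤ trimmedTest α W (x, μ) :=
    le_iSup_of_le (max n (w.1 + 1)) (le_iSup_of_le (hint _) (le_iSup₂_of_le w
      ⟨hw', by omega, hx⟩ le_rfl))
  refine lt_of_lt_of_le ?_ (mul_le_mul_right hs 3)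
  have h3 : 3 * nnRatVal (w.1 + 1, 2) = (⌊c⌋₊ : ℝ≥0) + 1 := by
    rw [nnRatVal, hwk]
    push_cast
    rw [show (2 : ℝ≥0) + 1 = 3 by norm_num, mul_div_cancel₀ _ (by norm_num)]
  have h4 : c < 3 * nnRatVal (w.1 + 1, 2) := h3 ▸ Nat.lt_floor_add_one c
  exact_mod_cast ENNReal.coe_lt_coe.2 h4

end TrimmedTest

end AlgRandom

/-! ### The infimum as universal class test. -/

theorem mainTheorem8 {X : Type*} [MetricSpace X] [CompleteSpace X] [MeasurableSpace X]
    [BorelSpace X] (α : ℕ → X) (hα : AlgRandom.IsComputableMetricSpace α)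
    (C : Set (ProbabilityMeasure X))
    (hC : AlgRandom.EffectivelyCompact (AlgRandom.measureBasis α) C)
    (t : X × ProbabilityMeasure X → ℝ≥0∞) (ht : AlgRandom.IsUniversalUniformTest α t) :
    AlgRandom.IsUniversalClassTest α C (fun x => ⨅ μ ∈ C, t (x, μ)) := by
  refine ⟨⟨ht.isUniformTest.lowerSemicomputable.iInf_of_effectivelyCompact hα
    (AlgRandom.isOpen_measureBasis α) hC, fun μ hμ => ?_⟩, fun f hf => ?_⟩
  · exact (lintegral_mono fun x => iInf₂_le μ hμ).trans (ht.isUniformTest.lintegral_le μ)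
  · obtain ⟨s, hs, hfs⟩ := hf.exists_isUniformTest
    obtain ⟨c, hc, hcs⟩ := ht.dominates s hs
    refine ⟨3 * c, by positivity, fun x => ?_⟩
    have h0 : ((3 * c : ℝ≥0) : ℝ≥0∞) ≠ 0 := ENNReal.coe_ne_zero.2 (by positivity)
    -- Dividing by the constant isolates the infimum, so the bound can be checked for each `μ ∈ C`
    -- separately.
    rw [mul_comm, ← ENNReal.div_le_iff h0 ENNReal.coe_ne_top]
    refine le_iInf₂ fun μ hμ => ?_
    rw [ENNReal.div_le_iff h0 ENNReal.coe_ne_top, mul_comm]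
    calc f x ≤ 3 * s (x, μ) := hfs x μ hμ
      _ ≤ 3 * (c * t (x, μ)) := mul_le_mul_right (hcs x μ) 3
      _ = ((3 * c : ℝ≥0) : ℝ≥0∞) * t (x, μ) := by
        push_cast
        rw [mul_assoc]
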